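/- Let $k$ be a field, let $G$ be a finite abelian group that splits over $k$ (the group algebra $kG$ is isomorphic, as a $k$-algebra, to a finite product of copies of $k$), and let $\mathcal C$ be an idempotent complete $k$-linear additive category with a $k$-linear $G$-action: $k$-linear autoequivalences $F_g\colon\mathcal C\to\mathcal C$ and natural isomorphisms $\varepsilon_{g,h}\colon F_gF_h\to F_{gh}$ ($g,h\in G$) with $\varepsilon_{gh,l}\circ\varepsilon_{g,h}F_l=\varepsilon_{g,hl}\circ F_g\varepsilon_{h,l}$ for all $g,h,l\in G$. A $G$-equivariant object is a pair $(X,\alpha)$ of an object $X$ of $\mathcal C$ and isomorphisms $\alpha_g\colon X\to F_g(X)$, $g\in G$, with $\alpha_{gh}=(\varepsilon_{g,h})_X\circ F_g(\alpha_h)\circ\alpha_g$; a morphism $(X,\alpha)\to(Y,\beta)$ is a morphism $f\colon X\to Y$ with $\beta_g\circ f=F_g(f)\circ\alpha_g$ for all $g$. These form a $k$-linear category $\mathcal C^G$. The character group $\widehat G=\mathrm{Hom}(G,k^*)$ acts strictly on $\mathcal C^G$ (the dual action): $\chi\in\widehat G$ acts by the automorphism $F_\chi$ with $F_\chi(X,\alpha)=(X,\chi\otimes\alpha)$,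 $(\chi\otimes\alpha)_g=\chi(g^{-1})\alpha_g$, and $F_\chi(f)=f$ on morphisms; all structure isomorphisms $F_\chi F_\psi=F_{\chi\psi}$ are identities. For a $k$-linear action of a group $H$ on a $k$-linear category $\mathcal D$, given by functors $F_h$ and isomorphisms $\varepsilon_{h,h'}$, an $H$-equivariant autoequivalence of $\mathcal D$ is a pair $(F,\delta)$ of a $k$-linear autoequivalence $F$ of $\mathcal D$ and natural isomorphisms $\delta_h\colon FF_h\to F_hF$, $h\in H$, with $\delta_{hh'}\circ F\varepsilon_{h,h'}=\varepsilon_{h,h'}F\circ F_h\delta_{h'}\circ\delta_hF_{h'}$. It is strictly equivariant if $FF_h=F_hF$ and $\delta_h$ is the identity for every $h$. Two such pairs $(F,\delta)$ and $(F',\delta')$ are isomorphic if there is a natural isomorphism $\phi\colon F\to F'$ with $F_h\phi\circ\delta_h=\delta'_h\circ\phi F_h$ for all $h$. The isomorphism classes $[F,\delta]$ form a group $\mathrm{Aut}(\mathcal D;H)$ under the multiplication induced by the composition $(E,\partial)(F,\delta)=(EF,(\partial_hF\circ E\delta_h)_{h\in H})$. A $G$-equivariant autoequivalence $(F,\delta)$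 of $\mathcal C$ induces the autoequivalence $(F,\delta)^G$ of $\mathcal C^G$ that sends $(X,\alpha)$ to $(F(X),((\delta_g)_X\circ F(\alpha_g))_{g\in G})$ and acts on morphisms by $F$; together with identity isomorphisms it is a strictly $\widehat G$-equivariant autoequivalence with respect to the dual action. This defines the equivariantization homomorphism $$(-)^G\colon \mathrm{Aut}(\mathcal C;G)\longrightarrow\mathrm{Aut}(\mathcal C^G;\widehat G),\qquad [F,\delta]\mapsto[(F,\delta)^G].$$ **Theorem.** The homomorphism $(-)^G$ is an isomorphism of groups. In particular, every $\widehat G$-equivariant autoequivalence of $\mathcal C^G$ is isomorphic to a strictly $\widehat G$-equivariant autoequivalence. -/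

import Mathlib

open CategoryTheory CategoryTheory.Limits

universe w' w v u

namespace Equivariantization

/-- A `k`-linear action of a group `G` on a `k`-linear category `C`: `k`-linear autoequivalences
`F g` with natural isomorphisms `ε g h : F_g F_h ≅ F_{gh}` satisfying the 2-cocycle condition.
In diagrammatic order the composite functor `F_g F_h` is `F h ⋙ F g`. The `eqToHom` only
identifies `F_{g(hl)}` with `F_{(gh)l}`. -/
structure LinearAction (k : Type w') [Field k] (G : Type w) [Group G]
    (C : Type u) [Category.{v} C] [Preadditive C] [CategoryTheory.Linear k C] where
  F : G → C ⥤ C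
  isEquivalence : ∀ g, (F g).IsEquivalence
  additive : ∀ g, (F g).Additive
  linear : ∀ g, (F g).Linear k
  ε : ∀ g h, F h ⋙ F g ≅ F (g * h)
  cocycle : ∀ (g h l : G) (X : C),
    (ε g h).hom.app ((F l).obj X) ≫ (ε (g * h) l).hom.app X =
      (F g).map ((ε h l).hom.app X) ≫ (ε g (h * l)).hom.app X ≫
        eqToHom (by rw [mul_assoc])

attribute [instance] LinearAction.isEquivalence LinearAction.additive LinearAction.linear

section

variable {k : Type w'} [Field k] {G : Type w} [Group G]
  {C : Type u} [Category.{v} C] [Preadditive C] [CategoryTheory.Linear k C]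

/-! ### The category of equivariant objects -/

/-- A `G`-equivariant object `(X, α)`: isomorphisms `α g : X ≅ F_g X` with
`α_{gh} = (ε_{g,h})_X ∘ F_g(α_h) ∘ α_g`. -/
structure EquivObj (A : LinearAction k G C) where
  X : C
  α : ∀ g, X ≅ (A.F g).obj X
  rel : ∀ g h, (α (g * h)).hom = (α g).hom ≫ (A.F g).map (α h).hom ≫ (A.ε g h).hom.app X

namespace EquivObj

variable {A : LinearAction k G C}

/-- A morphism `(X, α) ⟶ (Y, β)`: a morphism `f : X ⟶ Y` with `β_g ∘ f = F_g(f) ∘ α_g`. -/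
@[ext]
structure Hom (P Q : EquivObj A) where
  f : P.X ⟶ Q.X
  comm : ∀ g, f ≫ (Q.α g).hom = (P.α g).hom ≫ (A.F g).map f

instance : Category.{v} (EquivObj A) where
  Hom P Q := Hom P Q
  id P := ⟨𝟙 P.X, by simp⟩
  comp a b := ⟨a.f ≫ b.f, fun g => by
    rw [Category.assoc, b.comm, ← Category.assoc, a.comm, Category.assoc, Functor.map_comp]⟩

@[ext]
theorem hom_ext {P Q : EquivObj A} {a b : P ⟶ Q} (h : a.f = b.f) : a = b := Hom.ext h

@[simp] theorem id_f (P : EquivObj A) : Hom.f (𝟙 P) = 𝟙 P.X := rfl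

@[simp] theorem comp_f {P Q R : EquivObj A} (a : P ⟶ Q) (b : Q ⟶ R) :
    (a ≫ b).f = a.f ≫ b.f := rfl

/-- An isomorphism in `C` that is a morphism of equivariant objects is an isomorphism there. -/
@[simps]
def isoMk {P Q : EquivObj A} (i : P.X ≅ Q.X)
    (h : ∀ g, i.hom ≫ (Q.α g).hom = (P.α g).hom ≫ (A.F g).map i.hom) : P ≅ Q where
  hom := ⟨i.hom, h⟩
  inv := ⟨i.inv, fun g => by
    rw [Iso.inv_comp_eq, ← Category.assoc, h, Category.assoc, ← Functor.map_comp]; simp⟩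

section Linear

variable (P Q : EquivObj A)

instance : Zero (P ⟶ Q) := ⟨⟨0, by simp⟩⟩
instance : Add (P ⟶ Q) := ⟨fun a b => ⟨a.f + b.f, by simp [a.comm, b.comm]⟩⟩
instance : Neg (P ⟶ Q) := ⟨fun a => ⟨-a.f, by simp [a.comm]⟩⟩
instance : Sub (P ⟶ Q) := ⟨fun a b => ⟨a.f - b.f, by simp [a.comm, b.comm]⟩⟩
instance : SMul ℕ (P ⟶ Q) := ⟨fun n a => ⟨n • a.f, by simp [a.comm]⟩⟩
instance : SMul ℤ (P ⟶ Q) := ⟨fun n a => ⟨n • a.f, by simp [a.comm]⟩⟩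
instance : SMul k (P ⟶ Q) := ⟨fun c a => ⟨c • a.f, by simp [a.comm]⟩⟩

theorem f_injective : Function.Injective (fun a : P ⟶ Q => a.f) := fun _ _ h => hom_ext h

instance : AddCommGroup (P ⟶ Q) :=
  (f_injective P Q).addCommGroup _ rfl (fun _ _ => rfl) (fun _ => rfl) (fun _ _ => rfl)
    (fun _ _ => rfl) (fun _ _ => rfl)

variable {P Q}

@[simp] theorem add_f (a b : P ⟶ Q) : (a + b).f = a.f + b.f := rfl

@[simp] theorem smul_f (c : k) (a : P ⟶ Q) : (c • a).f = c • a.f := rfl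

variable (P Q)

/-- Forgetting the equivariant structure, as an additive map on morphisms. -/
def fHom : (P ⟶ Q) →+ (P.X ⟶ Q.X) where
  toFun a := a.f
  map_zero' := rfl
  map_add' _ _ := rfl

instance : Module k (P ⟶ Q) :=
  (f_injective P Q).module k (fHom P Q) (fun _ _ => rfl)

end Linear

instance : Preadditive (EquivObj A) where
  add_comp _ _ _ _ _ _ := by ext; simp
  comp_add _ _ _ _ _ _ := by ext; simp

instance : CategoryTheory.Linear k (EquivObj A) where
  smul_comp _ _ _ _ _ _ := by ext; simp
  comp_smul _ _ _ _ _ _ := by ext; simp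

end EquivObj

/-! ### The dual action of the character group -/

variable (A : LinearAction k G C)

/-- `F_χ (X, α) = (X, χ ⊗ α)` with `(χ ⊗ α)_g = χ(g⁻¹) α_g`. -/
abbrev twistObj (χ : G →* kˣ) (P : EquivObj A) : EquivObj A where
  X := P.X
  α g :=
    { hom := ((χ g⁻¹ : kˣ) : k) • (P.α g).hom
      inv := ((χ g : kˣ) : k) • (P.α g).inv
      hom_inv_id := by simp [smul_smul]
      inv_hom_id := by simp [smul_smul] }
  rel g h := by
    simp only [P.rel, mul_inv_rev, map_mul, Units.val_mul, Functor.map_smul,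
      CategoryTheory.Linear.smul_comp, CategoryTheory.Linear.comp_smul, smul_smul]

@[simp]
theorem twistObj_α_hom (χ : G →* kˣ) (P : EquivObj A) (g : G) :
    ((twistObj A χ P).α g).hom = ((χ g⁻¹ : kˣ) : k) • (P.α g).hom := rfl

/-- The automorphism `F_χ` of `C^G`; it is the identity on morphisms. -/
abbrev twist (χ : G →* kˣ) : EquivObj A ⥤ EquivObj A where
  obj P := twistObj A χ P
  map {P Q} a := ⟨a.f, fun g => by
    simp only [ CategoryTheory.Linear.comp_smul,
      CategoryTheory.Linear.smul_comp, a.comm]⟩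

/-- `F_χ F_ψ = F_{χψ}` on objects; the underlying morphism in `C` is the identity. -/
def twistCompIso (χ ψ : G →* kˣ) (P : EquivObj A) :
    (twist A χ).obj ((twist A ψ).obj P) ≅ (twist A (χ * ψ)).obj P :=
  EquivObj.isoMk (Iso.refl P.X) fun g => by simp [smul_smul]

instance (χ : G →* kˣ) : (twist A χ).Faithful where
  map_injective h := EquivObj.hom_ext (congrArg EquivObj.Hom.f h :)

theorem EquivObj.ext_α {A : LinearAction k G C} {X : C} {α β : ∀ g, X ≅ (A.F g).obj X} {h h'}
    (e : ∀ g, (α g).hom = (β g).hom) : EquivObj.mk (A := A) X α h = ⟨X, β, h'⟩ := by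
  obtain rfl : α = β := funext fun g => Iso.ext (e g)
  rfl

theorem twist_obj_one (P : EquivObj A) : (twist A 1).obj P = P :=
  EquivObj.ext_α fun g => by simp

theorem twist_obj_mul (χ ψ : G →* kˣ) (P : EquivObj A) :
    (twist A χ).obj ((twist A ψ).obj P) = (twist A (χ * ψ)).obj P :=
  EquivObj.ext_α fun g => by simp [smul_smul]

instance (χ : G →* kˣ) : (twist A χ).Full where
  map_surjective {P Q} b := by
    refine ⟨⟨b.f, fun g => ?_⟩, rfl⟩
    have h := b.comm g
    simp only [ CategoryTheory.Linear.comp_smul,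
      CategoryTheory.Linear.smul_comp] at h
    have h2 := congrArg (fun z => ((χ g : kˣ) : k) • z) h
    simpa [smul_smul] using h2

instance (χ : G →* kˣ) : (twist A χ).EssSurj where
  mem_essImage P := ⟨(twist A χ⁻¹).obj P, ⟨eqToIso ((twist_obj_mul A χ χ⁻¹ P).trans
    ((congrArg (fun θ => (twist A θ).obj P) (mul_inv_cancel χ)).trans (twist_obj_one A P)))⟩⟩

theorem eqToHom_f {P Q : EquivObj A} (h : P = Q) :
    EquivObj.Hom.f (eqToHom h) = eqToHom (congrArg EquivObj.X h) := by
  subst h; rfl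

/-- The dual action of the character group `Ĝ = Hom(G, kˣ)` on `C^G`. It is strict: its structure
isomorphisms are identities. -/
abbrev dualAction : LinearAction k (G →* kˣ) (EquivObj A) where
  F := twist A
  isEquivalence χ := {}
  additive χ := { map_add := rfl }
  linear χ := { map_smul := fun _ _ => rfl }
  ε χ ψ := NatIso.ofComponents (twistCompIso A χ ψ) fun {P Q} a => by
    ext
    change a.f ≫ 𝟙 Q.X = 𝟙 P.X ≫ a.f
    simp
  cocycle χ ψ θ P := by
    ext
    simp only [EquivObj.comp_f, eqToHom_f]
    change 𝟙 P.X ≫ 𝟙 P.X = 𝟙 P.X ≫ 𝟙 P.X ≫ 𝟙 P.X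
    simp

/-- The dual action is strict. -/
theorem dualAction_strict (χ ψ : G →* kˣ) :
    ∃ h : (dualAction A).F ψ ⋙ (dualAction A).F χ = (dualAction A).F (χ * ψ),
      (dualAction A).ε χ ψ = eqToIso h := by
  refine ⟨CategoryTheory.Functor.ext (twist_obj_mul A χ ψ) fun P Q a => ?_, ?_⟩
  · ext
    simp only [EquivObj.comp_f, eqToHom_f]
    change a.f = 𝟙 P.X ≫ a.f ≫ 𝟙 Q.X
    simp
  · ext P
    rw [eqToIso.hom, eqToHom_app, eqToHom_f]
    rfl

/-! ### Equivariant autoequivalences -/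

/-- A `k`-linear `G`-equivariant autoequivalence `(F, δ)`, with `δ g : F F_g ≅ F_g F` and
`δ_{gh} ∘ F ε_{g,h} = ε_{g,h} F ∘ F_g δ_h ∘ δ_g F_h`. -/
structure EquivAut where
  F : C ⥤ C
  isEquivalence : F.IsEquivalence
  additive : F.Additive
  linear : F.Linear k
  δ : ∀ g, A.F g ⋙ F ≅ F ⋙ A.F g
  compat : ∀ (g h : G) (X : C),
    F.map ((A.ε g h).hom.app X) ≫ (δ (g * h)).hom.app X =
      (δ g).hom.app ((A.F h).obj X) ≫ (A.F g).map ((δ h).hom.app X) ≫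
        (A.ε g h).hom.app (F.obj X)

attribute [instance] EquivAut.isEquivalence EquivAut.additive EquivAut.linear

namespace EquivAut

variable {A}

/-- `(F, δ)` is strictly equivariant: `F F_g = F_g F` and `δ_g` is the identity, for each `g`. -/
def IsStrict (E : EquivAut A) : Prop :=
  ∀ g, ∃ h : A.F g ⋙ E.F = E.F ⋙ A.F g, E.δ g = eqToIso h

/-- `(F, δ)` and `(F', δ')` are isomorphic: there is a natural isomorphism `φ : F ≅ F'` with
`F_g φ ∘ δ_g = δ'_g ∘ φ F_g`. -/
def Isomorphic (E E' : EquivAut A) : Prop :=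
  ∃ φ : E.F ≅ E'.F, ∀ (g : G) (X : C),
    (E.δ g).hom.app X ≫ (A.F g).map (φ.hom.app X) =
      φ.hom.app ((A.F g).obj X) ≫ (E'.δ g).hom.app X

theorem Isomorphic.refl (E : EquivAut A) : Isomorphic E E :=
  ⟨Iso.refl _, by simp⟩

theorem Isomorphic.symm {E E' : EquivAut A} : Isomorphic E E' → Isomorphic E' E := by
  rintro ⟨φ, h⟩
  refine ⟨φ.symm, fun g X => ?_⟩
  have := h g X
  rw [← cancel_epi (φ.hom.app ((A.F g).obj X)),
    ← cancel_mono ((A.F g).map (φ.hom.app X))]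
  simp only [Category.assoc, Iso.symm_hom, Iso.hom_inv_id_app_assoc]
  rw [← Functor.map_comp, Iso.inv_hom_id_app, this]
  simp

theorem Isomorphic.trans {E E' E'' : EquivAut A} :
    Isomorphic E E' → Isomorphic E' E'' → Isomorphic E E'' := by
  rintro ⟨φ, h⟩ ⟨ψ, h'⟩
  refine ⟨φ ≪≫ ψ, fun g X => ?_⟩
  have e1 := h g X
  have e2 := h' g X
  simp only [Iso.trans_hom, NatTrans.comp_app, Functor.map_comp, Category.assoc]
  rw [reassoc_of% e1, e2]

variable (A) in
/-- Isomorphism of equivariant autoequivalences as an equivalence relation. -/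
def setoid : Setoid (EquivAut A) where
  r := Isomorphic
  iseqv := ⟨Isomorphic.refl, Isomorphic.symm, Isomorphic.trans⟩

variable (A) in
/-- The identity equivariant autoequivalence. -/
abbrev id : EquivAut A where
  F := 𝟭 C
  isEquivalence := inferInstance
  additive := inferInstance
  linear := inferInstance
  δ g := Functor.rightUnitor _ ≪≫ (Functor.leftUnitor _).symm
  compat g h X := by simp

/-- The composite `(E, ∂)(F, δ) = (EF, ∂F ∘ Eδ)`. -/
abbrev comp (E E' : EquivAut A) : EquivAut A where
  F := E'.F ⋙ E.F
  isEquivalence := inferInstance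
  additive := inferInstance
  linear := inferInstance
  δ g := NatIso.ofComponents
    (fun X => E.F.mapIso ((E'.δ g).app X) ≪≫ (E.δ g).app (E'.F.obj X))
    (fun {X Y} f => by
      have e1 := (E'.δ g).hom.naturality f
      have e2 := (E.δ g).hom.naturality (E'.F.map f)
      dsimp at e1 e2 ⊢
      rw [← Category.assoc, ← Functor.map_comp, e1, Functor.map_comp, Category.assoc, e2,
        Category.assoc])
  compat g h X := by
    have e1 := E'.compat g h X
    have e2 := E.compat g h (E'.F.obj X)
    have e3 := (E.δ g).hom.naturality ((E'.δ h).hom.app X)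
    dsimp at e1 e2 e3 ⊢
    rw [← Category.assoc, ← Functor.map_comp, e1]
    simp only [Functor.map_comp, Category.assoc]
    rw [e2, reassoc_of% e3]

/-- Preservation of isomorphism under composition. -/
theorem comp_congr {E₁ E₂ E₁' E₂' : EquivAut A} (h : Isomorphic E₁ E₂)
    (h' : Isomorphic E₁' E₂') : Isomorphic (E₁.comp E₁') (E₂.comp E₂') := by
  obtain ⟨φ, h⟩ := h
  obtain ⟨ψ, h'⟩ := h'
  refine ⟨Functor.isoWhiskerRight ψ E₁.F ≪≫ Functor.isoWhiskerLeft E₂'.F φ, fun g X => ?_⟩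
  have e1 := h' g X
  have e2 := h g (E₂'.F.obj X)
  have e3 := (E₁.δ g).hom.naturality (ψ.hom.app X)
  have e4 := φ.hom.naturality ((E₂'.δ g).hom.app X)
  simp only [comp] at *
  dsimp at e1 e2 e3 e4 ⊢
  simp only [Functor.map_comp, Category.assoc] at *
  rw [← reassoc_of% e3, e2, ← Category.assoc, ← Functor.map_comp, e1, Functor.map_comp,
    Category.assoc, reassoc_of% e4]

/-- Every equivariant autoequivalence has a quasi-inverse. -/
theorem exists_inv (E : EquivAut A) : ∃ E' : EquivAut A, Isomorphic (E'.comp E) (id A) := by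
  let e := E.F.asEquivalence
  have hadd : e.functor.Additive := E.additive
  have hlin : e.functor.Linear k := E.linear
  let c : ∀ X, E.F.obj (E.F.inv.obj X) ≅ X := fun X => e.counitIso.app X
  have cnat : ∀ {X Y : C} (f : X ⟶ Y),
      E.F.map (E.F.inv.map f) ≫ (c Y).hom = (c X).hom ≫ f :=
    fun f => e.counitIso.hom.naturality f
  let d : ∀ g X, E.F.inv.obj ((A.F g).obj X) ≅ (A.F g).obj (E.F.inv.obj X) := fun g X =>
    E.F.preimageIso (c _ ≪≫ (A.F g).mapIso (c X).symm ≪≫ ((E.δ g).app _).symm)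
  -- the defining property of the components `d`
  have hd : ∀ g X, E.F.map (d g X).hom ≫ (E.δ g).hom.app (E.F.inv.obj X) ≫
      (A.F g).map (c X).hom = (c _).hom := fun g X => by
    simp only [d, Functor.preimageIso_hom, Functor.map_preimage, Iso.trans_hom, Category.assoc,
      Functor.mapIso_hom, Iso.symm_hom, Iso.app_inv]
    rw [Iso.inv_hom_id_app_assoc, ← Functor.map_comp, Iso.inv_hom_id]
    simp
  -- a morphism is determined by its image composed with the isomorphism below
  have hinj : ∀ (g : G) {Z X : C} (a b : Z ⟶ (A.F g).obj (E.F.inv.obj X)),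
      E.F.map a ≫ (E.δ g).hom.app (E.F.inv.obj X) ≫ (A.F g).map (c X).hom =
      E.F.map b ≫ (E.δ g).hom.app (E.F.inv.obj X) ≫ (A.F g).map (c X).hom → a = b := by
    intro g Z X a b h
    exact E.F.map_injective ((cancel_mono _).1 h)
  have hnat : ∀ g {X Y : C} (f : X ⟶ Y), E.F.inv.map ((A.F g).map f) ≫ (d g Y).hom =
      (d g X).hom ≫ (A.F g).map (E.F.inv.map f) := by
    intro g X Y f
    apply hinj
    have n1 := (E.δ g).hom.naturality (E.F.inv.map f)
    dsimp at n1
    simp only [Functor.map_comp, Category.assoc]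
    rw [hd, cnat, reassoc_of% n1, ← (A.F g).map_comp, cnat, (A.F g).map_comp,
      reassoc_of% (hd g X)]
  refine ⟨{ F := E.F.inv
            isEquivalence := inferInstance
            additive := inferInstanceAs e.inverse.Additive
            linear := inferInstanceAs (e.inverse.Linear k)
            δ := fun g => NatIso.ofComponents (d g) (fun f => hnat g f)
            compat := ?_ }, ?_⟩
  · intro g h X
    apply hinj
    have n1 := (A.ε g h).hom.naturality (c X).hom
    have n2 := E.compat g h (E.F.inv.obj X)
    have n3 := (E.δ g).hom.naturality (d h X).hom
    dsimp at n1 n2 n3 ⊢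
    simp only [Functor.map_comp, Category.assoc]
    rw [hd, cnat, reassoc_of% n2, reassoc_of% n3, ← n1]
    rw [← reassoc_of% (hd g ((A.F h).obj X)), ← hd h X]
    simp only [Functor.map_comp, Category.assoc]
  · obtain ⟨t, ht⟩ : ∃ t : E.F ⋙ E.F.inv ≅ 𝟭 C, ∀ X, (c (E.F.obj X)).hom =
        E.F.map (t.hom.app X) := ⟨e.unitIso.symm, fun X => e.counit_app_functor X⟩
    refine ⟨t, fun g X => ?_⟩
    have h1 := hd g (E.F.obj X)
    have n1 := (E.δ g).hom.naturality (t.hom.app X)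
    have n3 := cnat ((E.δ g).hom.app X)
    apply E.F.map_injective
    rw [← cancel_mono ((E.δ g).hom.app X)]
    rw [ht] at h1
    have n4 := ht ((A.F g).obj X)
    dsimp at n1 n3 n4 h1 ⊢
    simp only [Functor.map_comp, Category.assoc, Category.comp_id]
    rw [n1, h1, n3, n4]

variable (A) in
/-- The group `Aut(C; G)` of isomorphism classes `[F, δ]` of `k`-linear `G`-equivariant
autoequivalences. -/
def AutGroup : Type _ := Quotient (setoid A)

/-- The isomorphism class `[F, δ]`. -/
def cls (E : EquivAut A) : AutGroup A := Quotient.mk (setoid A) E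

theorem cls_eq_iff {E E' : EquivAut A} : cls E = cls E' ↔ Isomorphic E E' := Quotient.eq

/-- Multiplication is induced by composition: `[E][E'] = [EE']`. -/
instance : Mul (AutGroup A) :=
  ⟨Quotient.map₂ comp fun _ _ h _ _ h' => comp_congr h h'⟩

theorem cls_mul (E E' : EquivAut A) : cls E * cls E' = cls (E.comp E') := rfl

instance : One (AutGroup A) := ⟨cls (id A)⟩

theorem exists_cls_inv (x : AutGroup A) : ∃ y : AutGroup A, y * x = 1 := by
  obtain ⟨E, rfl⟩ := Quotient.exists_rep x
  obtain ⟨E', h⟩ := exists_inv E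
  exact ⟨cls E', cls_eq_iff.2 h⟩

noncomputable instance : Inv (AutGroup A) := ⟨fun x => (exists_cls_inv x).choose⟩

noncomputable instance : Group (AutGroup A) :=
  Group.ofLeftAxioms
    (by
      rintro ⟨E₁⟩ ⟨E₂⟩ ⟨E₃⟩
      exact cls_eq_iff.2 ⟨Iso.refl _, fun g X => by simp⟩)
    (by
      rintro ⟨E⟩
      exact cls_eq_iff.2 ⟨Iso.refl _, fun g X => by simp⟩)
    (fun x => (exists_cls_inv x).choose_spec)

/-! ### Equivariantization -/

/-- The object part of `(F, δ)^G`: it sends `(X, α)` to `(F X, α̃)` with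
`α̃_g = (δ_g)_X ∘ F(α_g)`. -/
abbrev liftObj (E : EquivAut A) (P : EquivObj A) : EquivObj A where
  X := E.F.obj P.X
  α g := E.F.mapIso (P.α g) ≪≫ (E.δ g).app P.X
  rel g h := by
    have n1 := (E.δ g).hom.naturality (P.α h).hom
    have n2 := E.compat g h P.X
    dsimp at n1 n2 ⊢
    simp only [P.rel, Functor.map_comp, Category.assoc]
    rw [n2, reassoc_of% n1]

/-- The functor `(F, δ)^G : C^G ⥤ C^G`, acting on morphisms by `F`. -/
abbrev lift (E : EquivAut A) : EquivObj A ⥤ EquivObj A where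
  obj P := E.liftObj P
  map {P Q} a := ⟨E.F.map a.f, fun g => by
    have n1 := (E.δ g).hom.naturality a.f
    dsimp at n1 ⊢
    rw [← Category.assoc, ← Functor.map_comp, a.comm, Functor.map_comp, Category.assoc, n1,
      Category.assoc]⟩
  map_id _ := by ext; simp
  map_comp _ _ := by ext; simp

instance (E : EquivAut A) : E.lift.Faithful where
  map_injective h := EquivObj.hom_ext (E.F.map_injective (congrArg EquivObj.Hom.f h :))

instance (E : EquivAut A) : E.lift.Full where
  map_surjective {P Q} b := by
    obtain ⟨a, ha⟩ := E.F.map_surjective b.f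
    refine ⟨⟨a, fun g => ?_⟩, EquivObj.hom_ext ha⟩
    apply E.F.map_injective
    have h := b.comm g
    have n1 := (E.δ g).hom.naturality a
    dsimp at h n1
    rw [← ha, Category.assoc, ← n1, ← Category.assoc, ← Category.assoc, cancel_mono] at h
    simpa using h

instance (E : EquivAut A) : E.lift.EssSurj where
  mem_essImage Q := by
    let X := E.F.objPreimage Q.X
    let t : E.F.obj X ≅ Q.X := E.F.objObjPreimageIso Q.X
    let a : ∀ g, X ≅ (A.F g).obj X := fun g =>
      E.F.preimageIso (t ≪≫ Q.α g ≪≫ (A.F g).mapIso t.symm ≪≫ ((E.δ g).app X).symm)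
    have ha : ∀ g, E.F.map (a g).hom ≫ (E.δ g).hom.app X ≫ (A.F g).map t.hom =
        t.hom ≫ (Q.α g).hom := fun g => by
      simp only [a, Functor.preimageIso_hom, Functor.map_preimage, Iso.trans_hom, Category.assoc,
        Functor.mapIso_hom, Iso.symm_hom, Iso.app_inv]
      rw [Iso.inv_hom_id_app_assoc, ← Functor.map_comp, Iso.inv_hom_id]
      simp
    refine ⟨⟨X, a, fun g h => ?_⟩, ⟨EquivObj.isoMk t fun g => ?_⟩⟩
    · apply E.F.map_injective
      rw [← cancel_mono ((E.δ (g * h)).hom.app X ≫ (A.F (g * h)).map t.hom)]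
      have n1 := (A.ε g h).hom.naturality t.hom
      have n2 := E.compat g h X
      have n3 := (E.δ g).hom.naturality (a h).hom
      dsimp at n1 n2 n3 ⊢
      rw [ha, Q.rel]
      simp only [Functor.map_comp, Category.assoc]
      rw [reassoc_of% n2, reassoc_of% n3, ← n1, ← reassoc_of% (ha g)]
      simp only [← Functor.map_comp_assoc, ha h]
    · have h := ha g
      dsimp at h ⊢
      rw [Category.assoc, h]

/-- `F_χ (F, δ)^G = (F, δ)^G F_χ` on objects. -/
theorem lift_twist_obj (E : EquivAut A) (χ : G →* kˣ) (P : EquivObj A) :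
    E.lift.obj ((twist A χ).obj P) = (twist A χ).obj (E.lift.obj P) :=
  EquivObj.ext_α fun g => by simp

/-- `F_χ (F, δ)^G = (F, δ)^G F_χ` as functors. -/
theorem lift_twist (E : EquivAut A) (χ : G →* kˣ) :
    twist A χ ⋙ E.lift = E.lift ⋙ twist A χ :=
  CategoryTheory.Functor.ext (E.lift_twist_obj χ) fun P Q a => by
    ext
    simp only [EquivObj.comp_f, eqToHom_f]
    change E.F.map a.f = 𝟙 _ ≫ E.F.map a.f ≫ 𝟙 _
    simp

/-- The equivariantization of `(F, δ)`: the functor `(F, δ)^G` with identity structure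
isomorphisms, a strictly `Ĝ`-equivariant autoequivalence of `C^G`. -/
abbrev equivariantization (E : EquivAut A) : EquivAut (dualAction A) where
  F := E.lift
  isEquivalence := {}
  additive := { map_add := EquivObj.hom_ext E.F.map_add }
  linear := { map_smul := fun f r => EquivObj.hom_ext (E.F.map_smul r f.f) }
  δ χ := eqToIso (E.lift_twist χ)
  compat χ ψ P := by
    ext
    simp only [EquivObj.comp_f, eqToIso.hom, eqToHom_app, eqToHom_f]
    change E.F.map (𝟙 P.X) ≫ 𝟙 _ = 𝟙 _ ≫ 𝟙 _ ≫ 𝟙 _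
    simp

theorem equivariantization_δ_f (E : EquivAut A) (χ : G →* kˣ) (P : EquivObj A) :
    ((E.equivariantization.δ χ).hom.app P).f = 𝟙 (E.F.obj P.X) := by
  rw [eqToIso.hom, eqToHom_app, eqToHom_f]; rfl

theorem equivariantization_congr {E E' : EquivAut A} (h : Isomorphic E E') :
    Isomorphic E.equivariantization E'.equivariantization := by
  obtain ⟨φ, h⟩ := h
  refine ⟨NatIso.ofComponents (fun P => EquivObj.isoMk (φ.app P.X) fun g => ?_) ?_, ?_⟩
  · have e1 := h g P.X
    have e2 := φ.hom.naturality (P.α g).hom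
    dsimp at e1 e2 ⊢
    rw [Category.assoc, e1, reassoc_of% e2]
  · intro P Q a
    ext
    exact φ.hom.naturality a.f
  · intro χ P
    ext
    rw [EquivObj.comp_f, EquivObj.comp_f, equivariantization_δ_f, equivariantization_δ_f]
    change 𝟙 _ ≫ φ.hom.app P.X = φ.hom.app P.X ≫ 𝟙 _
    simp

theorem equivariantization_comp (E E' : EquivAut A) :
    Isomorphic (E.comp E').equivariantization
      (E.equivariantization.comp E'.equivariantization) := by
  refine ⟨NatIso.ofComponents (fun P => EquivObj.isoMk (Iso.refl _) fun g => ?_) ?_, ?_⟩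
  · simp
  · intro P Q a
    ext
    simp
  · intro χ P
    ext
    rw [EquivObj.comp_f, EquivObj.comp_f, equivariantization_δ_f]
    have e : (((E.equivariantization.comp E'.equivariantization).δ χ).hom.app P).f =
        E.F.map ((E'.equivariantization.δ χ).hom.app P).f ≫
          ((E.equivariantization.δ χ).hom.app (E'.lift.obj P)).f := rfl
    rw [e, equivariantization_δ_f, equivariantization_δ_f]
    change 𝟙 _ ≫ 𝟙 _ = 𝟙 _ ≫ E.F.map (𝟙 _) ≫ 𝟙 _
    simp

variable (A) in
/-- The equivariantization homomorphism `Aut(C; G) → Aut(C^G; Ĝ)`, `[F, δ] ↦ [(F, δ)^G]`. -/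
noncomputable def equivariantizationHom : AutGroup A →* AutGroup (dualAction A) :=
  MonoidHom.mk' (Quotient.map equivariantization fun _ _ h => equivariantization_congr h)
    (by
      rintro ⟨E⟩ ⟨E'⟩
      exact cls_eq_iff.2 (equivariantization_comp E E'))

theorem equivariantizationHom_cls (E : EquivAut A) :
    equivariantizationHom A (cls E) = cls E.equivariantization := rfl

end EquivAut

end

/-- A finite group `G` splits over `k`: the group algebra `kG` is isomorphic, as a `k`-algebra,
to a finite product of copies of `k`. -/
def SplitsOver (k : Type w') [Field k] (G : Type w) [Group G] : Prop :=
  ∃ n : ℕ, Nonempty (MonoidAlgebra k G ≃ₐ[k] (Fin n → k))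

end Equivariantization

/-! For equivariant objects `P`, `Q` the group acts on `P.X ⟶ Q.X` by conjugation (`EquivObj.conj`).
Splitting makes `|G|` invertible in `k` and provides `|G|` characters, so this space is the direct
sum over `χ` of its isotypic parts, and the part of degree `χ` is `P ⟶ F_χ Q` in `C^G`
(`component_self`, `component_of_ne`, `sum_component`). Thus the full subcategory of `C` on
underlying objects is the orbit category of `C^G` under the dual action. Every `X` is a retract of
the object underlying `⨁ F_g X` (`retractGenerates_forget`), so `C` is the idempotent completion of
that orbit category, and functors and natural isomorphisms need only be given there.

Injectivity: an isomorphism of equivariantizations compatible with the dual action is natural for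
morphisms of every degree, hence on the orbit category, hence on `C`. Surjectivity: a
dual-equivariant `(E, δ)` acts on degree `χ` by `E` followed by `δ_χ`. Summing over degrees gives a
fully faithful functor on the orbit category (`extendMap`), which extends to `C`; its
`G`-equivariant structure is read off from the structure isomorphisms of the objects `E P`. -/

namespace Equivariantization

/-! ### Characters of a split finite abelian group and their orthogonality -/

section Characters

variable {k : Type w'} [Field k] {G : Type w} [CommGroup G]

/-- The norm element `N = ∑ g` satisfies `N² = |G| N`. If `|G|` vanished in `k`, then `N` would be a
nonzero nilpotent in a ring isomorphic to a product of fields. -/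
theorem SplitsOver.card_ne_zero [Finite G] (h : SplitsOver k G) : (Nat.card G : k) ≠ 0 := by
  classical
  obtain ⟨n, ⟨e⟩⟩ := h
  have := Fintype.ofFinite G
  have hred : IsReduced (MonoidAlgebra k G) := isReduced_of_injective e e.injective
  intro h0
  let N : MonoidAlgebra k G := ∑ g : G, MonoidAlgebra.of k G g
  have hN : ∀ g : G, MonoidAlgebra.of k G g * N = N := fun g => by
    simp only [N, Finset.mul_sum, ← map_mul]
    exact Fintype.sum_equiv (Equiv.mulLeft g) _ _ fun _ => rfl
  have hNN : N * N = 0 := by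
    conv_lhs => rw [show N * N = ∑ g : G, MonoidAlgebra.of k G g * N from Finset.sum_mul ..]
    simp only [hN, Finset.sum_const, Finset.card_univ]
    rw [← Nat.card_eq_fintype_card, ← Nat.cast_smul_eq_nsmul k, h0, zero_smul]
  have hN0 : N = 0 := by
    have : IsNilpotent N := ⟨2, by rw [pow_two, hNN]⟩
    exact this.eq_zero
  have hli := (MonoidAlgebra.basis G k).linearIndependent
  rw [Fintype.linearIndependent_iff] at hli
  refine one_ne_zero (hli (fun _ => (1 : k)) ?_ 1)
  simpa [N] using hN0

theorem linearIndependent_characters :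
    LinearIndependent k (fun (χ : G →* kˣ) (g : G) => ((χ g : kˣ) : k)) := by
  have h := linearIndependent_monoidHom G k
  exact h.comp (fun χ : G →* kˣ => (Units.coeHom k).comp χ) fun χ ψ e => by
    ext g
    exact DFunLike.congr_fun e g

variable (k G) in
theorem finite_characters [Finite G] : Finite (G →* kˣ) :=
  (linearIndependent_characters (k := k) (G := G)).finite

/-- The characters of `G` given by the factors of the split group algebra. -/
noncomputable def factorCharacter {n : ℕ} (e : MonoidAlgebra k G ≃ₐ[k] (Fin n → k)) (i : Fin n) :
    G →* kˣ :=
  MonoidHom.toHomUnits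
    (((Pi.evalMonoidHom (fun _ : Fin n => k) i).comp (e : MonoidAlgebra k G →* (Fin n → k))).comp
      (MonoidAlgebra.of k G))

theorem factorCharacter_apply {n : ℕ} (e : MonoidAlgebra k G ≃ₐ[k] (Fin n → k)) (i : Fin n)
    (g : G) : ((factorCharacter e i g : kˣ) : k) = e (MonoidAlgebra.of k G g) i := rfl

/-- Equal characters extend to equal algebra maps `kG → k`, but the idempotent of the `i`-th factor
separates the `i`-th projection from the others. -/
theorem factorCharacter_injective {n : ℕ} (e : MonoidAlgebra k G ≃ₐ[k] (Fin n → k)) :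
    Function.Injective (factorCharacter e) := by
  classical
  intro i j h
  have key : ((Pi.evalAlgHom k (fun _ : Fin n => k) i).comp e.toAlgHom) =
      ((Pi.evalAlgHom k (fun _ : Fin n => k) j).comp e.toAlgHom) := by
    apply MonoidAlgebra.algHom_ext
    · intro g
      exact congrArg (fun χ : G →* kˣ => ((χ g : kˣ) : k)) h
    · exact Subsingleton.elim _ _
  by_contra hij
  have := DFunLike.congr_fun key (e.symm (Pi.single i 1))
  simp [Ne.symm hij] at this

/-- Dedekind's independence of characters bounds the number above by `|G|`; the projections to the
`n = dim kG` factors already give `|G|` characters. -/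
theorem SplitsOver.card_characters [Finite G] (h : SplitsOver k G) :
    Nat.card (G →* kˣ) = Nat.card G := by
  obtain ⟨n, ⟨e⟩⟩ := h
  have := Fintype.ofFinite G
  have := finite_characters k G
  have := Fintype.ofFinite (G →* kˣ)
  have h1 : Nat.card G = n := by
    have := e.toLinearEquiv.finrank_eq
    rw [Module.finrank_fin_fun] at this
    rw [← this, Module.finrank_eq_nat_card_basis (MonoidAlgebra.basis G k)]
  apply le_antisymm
  · have := (linearIndependent_characters (k := k) (G := G)).fintype_card_le_finrank
    simpa [Nat.card_eq_fintype_card] using this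
  · rw [h1]
    simpa using Nat.card_le_card_of_injective _ (factorCharacter_injective e)

/-- The coordinates of `e g` are the values at `g` of the factor characters, so if all of them are
`1` then `e g = e 1`. -/
theorem SplitsOver.exists_character_ne_one (h : SplitsOver k G) {g : G} (hg : g ≠ 1) :
    ∃ χ : G →* kˣ, χ g ≠ 1 := by
  obtain ⟨n, ⟨e⟩⟩ := h
  by_contra! hc
  apply hg
  apply MonoidAlgebra.of_injective (R := k)
  apply e.injective
  ext i
  rw [← factorCharacter_apply, ← factorCharacter_apply, hc, map_one]

theorem SplitsOver.sum_characters [Finite G] [Fintype (G →* kˣ)] [DecidableEq G] (h : SplitsOver k G)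
    (g : G) : ∑ χ : G →* kˣ, ((χ g : kˣ) : k) = if g = 1 then (Nat.card G : k) else 0 := by
  split_ifs with hg
  · subst hg
    simp [← h.card_characters, Nat.card_eq_fintype_card]
  · obtain ⟨ψ, hψ⟩ := h.exists_character_ne_one hg
    have key : ((ψ g : kˣ) : k) * ∑ χ : G →* kˣ, ((χ g : kˣ) : k) =
        ∑ χ : G →* kˣ, ((χ g : kˣ) : k) := by
      rw [Finset.mul_sum]
      exact Fintype.sum_equiv (Equiv.mulLeft ψ) _ _ fun χ => by simp
    by_contra hne
    exact hψ (Units.ext (mul_right_cancel₀ hne (key.trans (one_mul _).symm)))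

theorem sum_character_apply [Fintype G] [DecidableEq (G →* kˣ)] (χ : G →* kˣ) :
    ∑ g, ((χ g : kˣ) : k) = if χ = 1 then (Nat.card G : k) else 0 := by
  split_ifs with hχ
  · subst hχ
    simp [Nat.card_eq_fintype_card]
  · obtain ⟨h, hh⟩ : ∃ h, χ h ≠ 1 := by
      by_contra! hc
      exact hχ (MonoidHom.ext hc)
    have key : ((χ h : kˣ) : k) * ∑ g, ((χ g : kˣ) : k) = ∑ g, ((χ g : kˣ) : k) := by
      rw [Finset.mul_sum]
      exact Fintype.sum_equiv (Equiv.mulLeft h) _ _ fun g => by simp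
    by_contra hne
    exact hh (Units.ext (mul_right_cancel₀ hne (key.trans (one_mul _).symm)))

end Characters

/-! ### Extension along retracts -/

section Retracts

variable {C : Type u} [Category.{v} C] {D : Type*} [Category* D] {ι : Type*} {S : ι → C}

/-- Every object is a retract of a member of the family `S`. -/
def RetractGenerates (S : ι → C) : Prop := ∀ X, ∃ p, Nonempty (Retract X (S p))

namespace RetractGenerates

/-- The inclusion of `X` into some `S p` stays a split monomorphism under `F'`, so naturality along
it determines the component at `X`. -/
theorem natTrans_app_eq (hS : RetractGenerates S) {F F' : C ⥤ D} (a b : F ⟶ F')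
    (h : ∀ p, a.app (S p) = b.app (S p)) (X : C) : a.app X = b.app X := by
  obtain ⟨p, ⟨r⟩⟩ := hS X
  have := r.splitMono
  rw [← cancel_mono (F'.map r.i), ← a.naturality, ← b.naturality, h]

/-- The component at `X` is `η` cut down by the retraction. Naturality of `η` at the idempotent of
the retract makes it invertible, and naturality at `r ≫ f ≫ i` makes it natural. -/
theorem exists_natIso (hS : RetractGenerates S) {F F' : C ⥤ D}
    (η : ∀ p, F.obj (S p) ≅ F'.obj (S p))
    (nat : ∀ p q (f : S p ⟶ S q), F.map f ≫ (η q).hom = (η p).hom ≫ F'.map f) :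
    ∃ φ : F ≅ F', ∀ p, φ.hom.app (S p) = (η p).hom := by
  choose p r using hS
  have r := fun X => (r X).some
  have nat' : ∀ p q (f : S p ⟶ S q), F'.map f ≫ (η q).inv = (η p).inv ≫ F.map f := by
    intro p q f
    rw [Iso.comp_inv_eq, Category.assoc, nat, Iso.inv_hom_id_assoc]
  refine ⟨NatIso.ofComponents (fun X =>
    { hom := F.map (r X).i ≫ (η (p X)).hom ≫ F'.map (r X).r
      inv := F'.map (r X).i ≫ (η (p X)).inv ≫ F.map (r X).r
      hom_inv_id := ?_
      inv_hom_id := ?_ }) ?_, ?_⟩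
  · simp only [Category.assoc]
    rw [← F'.map_comp_assoc, reassoc_of% (nat' _ _ ((r X).r ≫ (r X).i)), Iso.hom_inv_id_assoc]
    (simp only [← Functor.map_comp]; simp)
  · simp only [Category.assoc]
    rw [← F.map_comp_assoc, reassoc_of% (nat _ _ ((r X).r ≫ (r X).i)), Iso.inv_hom_id_assoc]
    (simp only [← Functor.map_comp]; simp)
  · intro X Y f
    have := nat _ _ ((r X).r ≫ f ≫ (r Y).i)
    have e : F.map f ≫ F.map (r Y).i =
        F.map (r X).i ≫ F.map ((r X).r ≫ f ≫ (r Y).i) := by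
      (simp only [← Functor.map_comp]; simp)
    dsimp
    rw [reassoc_of% e, reassoc_of% this]
    (simp only [← Functor.map_comp]; simp)
  · intro q
    dsimp
    rw [← Category.assoc, nat _ _ (r (S q)).i, Category.assoc, ← F'.map_comp]
    simp

/-- A functor defined on the full subcategory of a family of objects that generates `C` up to
retracts extends to `C`, if the target is idempotent complete. -/
theorem exists_functor (hS : RetractGenerates S) [IsIdempotentComplete D] (T : ι → D)
    (m : ∀ {p q}, (S p ⟶ S q) → (T p ⟶ T q)) (m_id : ∀ p, m (𝟙 (S p)) = 𝟙 (T p))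
    (m_comp : ∀ {p q r} (f : S p ⟶ S q) (g : S q ⟶ S r), m (f ≫ g) = m f ≫ m g) :
    ∃ (E : C ⥤ D) (θ : ∀ p, E.obj (S p) ≅ T p),
      ∀ p q (f : S p ⟶ S q), E.map f ≫ (θ q).hom = (θ p).hom ≫ m f := by
  choose p r using hS
  have r := fun X => (r X).some
  -- The value at `X` is the image of the idempotent that `m` assigns to the one cutting `X` out of
  -- `S (p X)`.
  have hs : ∀ X, ∃ (Y : D) (i : Y ⟶ T (p X)) (e : T (p X) ⟶ Y),
      i ≫ e = 𝟙 Y ∧ e ≫ i = m ((r X).r ≫ (r X).i) := fun X =>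
    IsIdempotentComplete.idempotents_split _ _ (by rw [← m_comp]; simp)
  choose Y i e hie hei using hs
  refine ⟨{ obj := Y
            map := fun {X Z} f => i X ≫ m ((r X).r ≫ f ≫ (r Z).i) ≫ e Z
            map_id := fun X => ?_
            map_comp := fun {X Z W} f g => ?_ }, fun q =>
    { hom := i _ ≫ m (r (S q)).r
      inv := m (r (S q)).i ≫ e _
      hom_inv_id := ?_
      inv_hom_id := ?_ }, ?_⟩
  · rw [Category.id_comp, ← hei]
    simp [hie]
  · simp only [Category.assoc]
    rw [reassoc_of% hei, ← reassoc_of% m_comp, ← reassoc_of% m_comp]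
    simp
  · simp only [Category.assoc]
    rw [← reassoc_of% m_comp, ← hei]
    simp [hie]
  · simp only [Category.assoc]
    rw [reassoc_of% hei, ← m_comp, ← m_comp]
    simp [m_id]
  · intro q q' f
    dsimp
    simp only [Category.assoc]
    rw [reassoc_of% hei, ← m_comp, ← m_comp, ← m_comp]
    simp

theorem faithful (hS : RetractGenerates S) (E : C ⥤ D)
    (h : ∀ p q (f g : S p ⟶ S q), E.map f = E.map g → f = g) : E.Faithful where
  map_injective {X Y} f g hfg := by
    obtain ⟨p, ⟨r⟩⟩ := hS X
    obtain ⟨q, ⟨s⟩⟩ := hS Y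
    have := h _ _ (r.r ≫ f ≫ s.i) (r.r ≫ g ≫ s.i) (by simp [hfg])
    simpa using congrArg (fun z => r.i ≫ z ≫ s.r) this

theorem full (hS : RetractGenerates S) (E : C ⥤ D)
    (h : ∀ p q (b : E.obj (S p) ⟶ E.obj (S q)), ∃ f, E.map f = b) : E.Full where
  map_surjective {X Y} b := by
    obtain ⟨p, ⟨r⟩⟩ := hS X
    obtain ⟨q, ⟨s⟩⟩ := hS Y
    obtain ⟨f, hf⟩ := h _ _ (E.map r.r ≫ b ≫ E.map s.i)
    refine ⟨r.i ≫ f ≫ s.r, ?_⟩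
    simp only [Functor.map_comp, hf, Category.assoc]
    rw [← E.map_comp_assoc, ← E.map_comp]
    simp

theorem additive [Preadditive C] [Preadditive D] (hS : RetractGenerates S) (E : C ⥤ D)
    (h : ∀ p q (f g : S p ⟶ S q), E.map (f + g) = E.map f + E.map g) : E.Additive where
  map_add {X Y f g} := by
    obtain ⟨p, ⟨r⟩⟩ := hS X
    obtain ⟨q, ⟨s⟩⟩ := hS Y
    have e : ∀ a : X ⟶ Y, E.map a = E.map r.i ≫ E.map (r.r ≫ a ≫ s.i) ≫ E.map s.r := fun a => by
      simp only [← Functor.map_comp]; simp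
    rw [e (f + g), e f, e g, Preadditive.add_comp, Preadditive.comp_add, h,
      Preadditive.add_comp, Preadditive.comp_add]

theorem linear {k : Type*} [Field k] [Preadditive C] [Preadditive D] [CategoryTheory.Linear k C]
    [CategoryTheory.Linear k D] (hS : RetractGenerates S) (E : C ⥤ D) [E.Additive]
    (h : ∀ p q (c : k) (f : S p ⟶ S q), E.map (c • f) = c • E.map f) : E.Linear k where
  map_smul {X Y} f c := by
    obtain ⟨p, ⟨r⟩⟩ := hS X
    obtain ⟨q, ⟨s⟩⟩ := hS Y
    have e : ∀ a : X ⟶ Y, E.map a = E.map r.i ≫ E.map (r.r ≫ a ≫ s.i) ≫ E.map s.r := fun a => by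
      simp only [← Functor.map_comp]; simp
    rw [e (c • f), e f, CategoryTheory.Linear.smul_comp, CategoryTheory.Linear.comp_smul, h,
      CategoryTheory.Linear.smul_comp, CategoryTheory.Linear.comp_smul]

end RetractGenerates

/-- The idempotent on `E.obj X` defining `Y` lifts to an idempotent of `X`. Its splitting in `C`
maps to a second splitting of the same idempotent, hence to an object isomorphic to `Y`. -/
theorem essSurj_of_retract [IsIdempotentComplete C] (E : C ⥤ D) [E.Full] [E.Faithful]
    (h : ∀ Y, ∃ X, Nonempty (Retract Y (E.obj X))) : E.EssSurj where
  mem_essImage Y := by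
    obtain ⟨X, ⟨r⟩⟩ := h Y
    obtain ⟨a, ha⟩ := E.map_surjective (r.r ≫ r.i)
    obtain ⟨Z, i, e, hie, hei⟩ := IsIdempotentComplete.idempotents_split X a
      (E.map_injective (by simp [ha]))
    have hei' : E.map e ≫ E.map i = r.r ≫ r.i := by rw [← E.map_comp, hei, ha]
    refine ⟨Z, ⟨⟨E.map i ≫ r.r, r.i ≫ E.map e, ?_, ?_⟩⟩⟩
    · simp only [Category.assoc]
      rw [← reassoc_of% hei', ← E.map_comp, ← E.map_comp_assoc, hie]
      simp
    · simp only [Category.assoc]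
      rw [reassoc_of% hei']
      simp

end Retracts

/-! ### Induced equivariant objects -/

section Induction

theorem biproduct_total {C : Type*} [Category* C] [Preadditive C] {J : Type*} [Fintype J]
    (f : J → C) [HasBiproduct f] : ∑ j, biproduct.π f j ≫ biproduct.ι f j = 𝟙 (⨁ f) :=
  IsBilimit.total (biproduct.isBilimit f)

theorem map_biproduct_hom_ext {C D : Type*} [Category* C] [Preadditive C] [Category* D]
    [Preadditive D] {J : Type*} [Fintype J] (L : C ⥤ D) [L.Additive] (f : J → C) [HasBiproduct f]
    {Z : D} {a b : L.obj (⨁ f) ⟶ Z}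
    (h : ∀ j, L.map (biproduct.ι f j) ≫ a = L.map (biproduct.ι f j) ≫ b) : a = b := by
  have e : ∀ c : L.obj (⨁ f) ⟶ Z,
      c = ∑ j, L.map (biproduct.π f j) ≫ L.map (biproduct.ι f j) ≫ c := fun c => by
    have := congrArg L.map (biproduct_total f)
    rw [L.map_sum, L.map_id] at this
    simp only [Functor.map_comp] at this
    simp only [← Category.assoc]
    rw [← Preadditive.sum_comp, this, Category.id_comp]
  rw [e a, e b]
  simp only [h]

variable {k : Type w'} [Field k] {G : Type w} [Group G] [Fintype G]
  {C : Type u} [Category.{v} C] [Preadditive C] [CategoryTheory.Linear k C]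
  [HasFiniteBiproducts C] (A : LinearAction k G C)

/-- The structure morphism `F_h (⨁ F_g X) ⟶ ⨁ F_g X` of the induced object. -/
noncomputable def indInv (X : C) (h : G) :
    (A.F h).obj (⨁ fun g => (A.F g).obj X) ⟶ ⨁ fun g => (A.F g).obj X :=
  ∑ g, (A.F h).map (biproduct.π _ g) ≫ (A.ε h g).hom.app X ≫
    biproduct.ι (fun g => (A.F g).obj X) (h * g)

/-- The structure morphism `⨁ F_g X ⟶ F_h (⨁ F_g X)` of the induced object. -/
noncomputable def indHom (X : C) (h : G) :
    (⨁ fun g => (A.F g).obj X) ⟶ (A.F h).obj (⨁ fun g => (A.F g).obj X) :=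
  ∑ g, biproduct.π (fun g => (A.F g).obj X) (h * g) ≫ (A.ε h g).inv.app X ≫
    (A.F h).map (biproduct.ι (fun g => (A.F g).obj X) g)

theorem map_ι_indInv (X : C) (h g : G) :
    (A.F h).map (biproduct.ι (fun g => (A.F g).obj X) g) ≫ indInv A X h =
      (A.ε h g).hom.app X ≫ biproduct.ι (fun g => (A.F g).obj X) (h * g) := by
  rw [indInv, Preadditive.comp_sum, Finset.sum_eq_single g]
  · rw [← Functor.map_comp_assoc, biproduct.ι_π_self]
    simp
  · intro g' _ hg
    rw [← Functor.map_comp_assoc, biproduct.ι_π_ne _ (Ne.symm hg)]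
    simp
  · simp

theorem ι_indHom (X : C) (h g : G) :
    biproduct.ι (fun g => (A.F g).obj X) (h * g) ≫ indHom A X h =
      (A.ε h g).inv.app X ≫ (A.F h).map (biproduct.ι (fun g => (A.F g).obj X) g) := by
  rw [indHom, Preadditive.comp_sum, Finset.sum_eq_single g]
  · rw [biproduct.ι_π_self_assoc]
  · intro g' _ hg
    rw [biproduct.ι_π_ne_assoc _ fun e => hg (mul_left_cancel e).symm]
    simp
  · simp

theorem indHom_indInv (X : C) (h : G) : indHom A X h ≫ indInv A X h = 𝟙 _ := by
  rw [indHom, Preadditive.sum_comp, ← biproduct_total]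
  refine Fintype.sum_equiv (Equiv.mulLeft h) _ _ fun g => ?_
  simp only [Category.assoc]
  rw [map_ι_indInv]
  simp

theorem indInv_indHom (X : C) (h : G) : indInv A X h ≫ indHom A X h = 𝟙 _ :=
  map_biproduct_hom_ext (A.F h) _ fun g => by
    rw [reassoc_of% map_ι_indInv A X h g, ι_indHom]
    simp

/-- The structure isomorphism of the induced object. -/
@[simps]
noncomputable def indIso (X : C) (h : G) :
    (⨁ fun g => (A.F g).obj X) ≅ (A.F h).obj (⨁ fun g => (A.F g).obj X) where
  hom := indHom A X h
  inv := indInv A X h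
  hom_inv_id := indHom_indInv A X h
  inv_hom_id := indInv_indHom A X h

/-- The induced equivariant object `⨁ F_g X`. -/
noncomputable def ind (X : C) : EquivObj A where
  X := ⨁ fun g => (A.F g).obj X
  α h := indIso A X h
  rel g h := by
    -- With the inverses moved across, both sides can be compared on the summands `F_g F_h F_l X`,
    -- where the identity becomes the cocycle condition.
    refine (cancel_epi (indIso A X g).inv).1 ?_
    refine (cancel_epi ((A.F g).mapIso (indIso A X h)).inv).1 ?_
    refine map_biproduct_hom_ext (A.F h ⋙ A.F g) _ fun l => ?_
    dsimp only [Functor.comp_map, Functor.comp_obj, Functor.mapIso_inv]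
    rw [Iso.inv_hom_id_assoc, Iso.map_inv_hom_id_assoc]
    rw [indIso_inv, indIso_inv, indIso_hom]
    rw [← Functor.map_comp_assoc, map_ι_indInv,
      Functor.map_comp, Category.assoc, reassoc_of% map_ι_indInv A X g (h * l)]
    have n := (A.ε g h).hom.naturality (biproduct.ι (fun g => (A.F g).obj X) l)
    dsimp at n
    rw [n]
    have e3 : ∀ {x y : G} (e : x = y), biproduct.ι (fun g => (A.F g).obj X) x =
        eqToHom (by rw [e]) ≫ biproduct.ι (fun g => (A.F g).obj X) y := by
      rintro x _ rfl
      simp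
    have c := A.cocycle g h l X
    rw [e3 (mul_assoc g h l).symm]
    simp only [Category.assoc]
    rw [← reassoc_of% c, ι_indHom]
    simp

/-- Every object is a retract of an object underlying an equivariant object. -/
theorem retractGenerates_forget :
    RetractGenerates (EquivObj.X (A := A)) := fun X => by
  -- No unit isomorphism is part of the action; `F_1 F_1 ≅ F_1` and full faithfulness of `F_1` yield
  -- one. So `X` is the summand `g = 1` of the induced object.
  obtain ⟨t⟩ : Nonempty ((A.F 1).obj X ≅ X) := ⟨(A.F 1).preimageIso
    ((A.ε 1 1).app X ≪≫ eqToIso (by rw [mul_one]))⟩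
  let r : Retract X (⨁ fun g => (A.F g).obj X) :=
    { i := t.inv ≫ biproduct.ι (fun g => (A.F g).obj X) 1
      r := biproduct.π (fun g => (A.F g).obj X) 1 ≫ t.hom
      retract := by rw [Category.assoc, biproduct.ι_π_self_assoc, Iso.inv_hom_id] }
  exact ⟨ind A X, ⟨r⟩⟩

end Induction

/-! ### Homogeneous components -/

section Homogeneous

variable {k : Type w'} [Field k] {G : Type w} [CommGroup G]
  {C : Type u} [Category.{v} C] [Preadditive C] [CategoryTheory.Linear k C]
  {A : LinearAction k G C}

namespace EquivObj

/-- The action of `G` on the morphisms in `C` between equivariant objects. -/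
def conj (P Q : EquivObj A) (g : G) : (P.X ⟶ Q.X) →ₗ[k] (P.X ⟶ Q.X) where
  toFun f := (P.α g).hom ≫ (A.F g).map f ≫ (Q.α g).inv
  map_add' f f' := by simp
  map_smul' c f := by simp

theorem conj_apply (P Q : EquivObj A) (g : G) (f : P.X ⟶ Q.X) :
    conj P Q g f = (P.α g).hom ≫ (A.F g).map f ≫ (Q.α g).inv := rfl

theorem conj_conj (P Q : EquivObj A) (g h : G) (f : P.X ⟶ Q.X) :
    conj P Q g (conj P Q h f) = conj P Q (g * h) f := by
  rw [← cancel_mono (Q.α (g * h)).hom]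
  have n := (A.ε g h).hom.naturality f
  dsimp at n
  simp only [conj_apply, Category.assoc, Iso.inv_hom_id, Category.comp_id]
  rw [P.rel, Q.rel]
  simp only [Functor.map_comp, Category.assoc, Iso.inv_hom_id_assoc]
  rw [← Functor.map_comp_assoc, ← Functor.map_comp_assoc]
  simp [n]

theorem conj_homogeneous {P Q : EquivObj A} {χ : G →* kˣ} (a : P ⟶ twistObj A χ Q) (g : G) :
    conj P Q g a.f = ((χ g⁻¹ : kˣ) : k) • a.f := by
  have h := a.comm g
  dsimp at h
  rw [conj_apply, ← Category.assoc, ← h]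
  simp

variable [Fintype G]

/-- The component `P ⟶ F_χ Q` of degree `χ` of a morphism `f : P.X ⟶ Q.X`. -/
noncomputable def component (P Q : EquivObj A) (χ : G →* kˣ)
    (f : P.X ⟶ Q.X) : P ⟶ twistObj A χ Q where
  f := (Nat.card G : k)⁻¹ • ∑ g, ((χ g : kˣ) : k) • conj P Q g f
  comm g := by
    -- Equivariance into the twist by `χ` says that `conj P Q g` acts as the scalar `χ(g⁻¹)`;
    -- translating the summation index by `g⁻¹` produces this scalar.
    rw [← cancel_mono (Q.α g).inv]
    have e : ((P.α g).hom ≫ (A.F g).map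
        ((Nat.card G : k)⁻¹ • ∑ h, ((χ h : kˣ) : k) • conj P Q h f)) ≫ (Q.α g).inv =
        conj P Q g ((Nat.card G : k)⁻¹ • ∑ h, ((χ h : kˣ) : k) • conj P Q h f) := by
      rw [conj_apply, Category.assoc]
    rw [e, map_smul, map_sum]
    simp only [map_smul, conj_conj, CategoryTheory.Linear.comp_smul,
      CategoryTheory.Linear.smul_comp, Category.assoc, Iso.hom_inv_id, Category.comp_id]
    rw [smul_comm, Finset.smul_sum]
    congr 1
    refine Fintype.sum_equiv (Equiv.mulLeft g⁻¹) _ _ fun h => ?_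
    simp [smul_smul]

variable {P Q : EquivObj A}

theorem component_f (χ : G →* kˣ) (f : P.X ⟶ Q.X) : (component P Q χ f).f =
    (Nat.card G : k)⁻¹ • ∑ g, ((χ g : kˣ) : k) • conj P Q g f := rfl

theorem component_add (χ : G →* kˣ) (f f' : P.X ⟶ Q.X) :
    component P Q χ (f + f') = component P Q χ f + component P Q χ f' := by
  ext
  simp [component_f, Finset.sum_add_distrib]

theorem component_smul (χ : G →* kˣ) (c : k) (f : P.X ⟶ Q.X) :
    component P Q χ (c • f) = c • component P Q χ f := by
  ext
  simp only [component_f, map_smul, smul_f]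
  simp only [smul_comm _ c, ← Finset.smul_sum]

theorem component_self (hG : (Nat.card G : k) ≠ 0) {χ : G →* kˣ} (a : P ⟶ twistObj A χ Q) : component P Q χ a.f = a := by
  ext
  simp only [component_f, conj_homogeneous, smul_smul, ← Units.val_mul, ← map_mul]
  rw [Nat.card_eq_fintype_card] at hG ⊢
  simp [← Nat.cast_smul_eq_nsmul k, smul_smul, hG]

theorem component_of_ne {χ ψ : G →* kˣ} (h : χ ≠ ψ) (a : P ⟶ twistObj A ψ Q) :
    component P Q χ a.f = 0 := by
  classical
  ext
  simp only [component_f, conj_homogeneous, smul_smul]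
  have e : ∀ g, ((χ g : kˣ) : k) * ((ψ g⁻¹ : kˣ) : k) = (((χ * ψ⁻¹) g : kˣ) : k) := fun g => by
    simp
  simp only [e, ← Finset.sum_smul]
  rw [sum_character_apply, if_neg fun h' => h (mul_inv_eq_one.1 h'), zero_smul, smul_zero]
  rfl

/-- After the two sums are exchanged, summing `χ g` over all characters kills every term except `g =
1`. -/
theorem sum_component [Fintype (G →* kˣ)] (hs : SplitsOver k G) (f : P.X ⟶ Q.X) :
    ∑ χ : G →* kˣ, (component P Q χ f).f = f := by
  classical
  simp only [component_f, ← Finset.smul_sum]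
  rw [Finset.sum_comm]
  simp only [← Finset.sum_smul, hs.sum_characters]
  -- Conjugation by `1` is idempotent, and it is injective since `F_1` is faithful.
  have h1 : conj P Q 1 f = f := by
    have h := conj_conj P Q 1 1 f
    rw [mul_one, conj_apply P Q 1 (conj P Q 1 f), conj_apply P Q 1 f, cancel_epi, cancel_mono] at h
    rw [conj_apply]
    exact (A.F 1).map_injective h
  have hG := hs.card_ne_zero
  rw [Nat.card_eq_fintype_card] at hG
  simp [smul_smul, hG, h1]

/-- Every morphism is a sum of homogeneous ones. -/
theorem homogeneous_induction (hs : SplitsOver k G) {p : (P.X ⟶ Q.X) → Prop}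
    (hadd : ∀ f f', p f → p f' → p (f + f'))
    (hom : ∀ (χ : G →* kˣ) (a : P ⟶ twistObj A χ Q), p a.f) (f : P.X ⟶ Q.X) : p f := by
  have := finite_characters k G
  have := Fintype.ofFinite (G →* kˣ)
  rw [← sum_component hs f]
  -- The empty sum is covered by the zero morphism, regarded as having trivial degree.
  exact Finset.sum_induction _ p hadd (hom 1 0) fun χ _ => hom χ _

end EquivObj

end Homogeneous

namespace EquivAut

section Isomorphism

variable {k : Type w'} [Field k] {G : Type w} [CommGroup G]
  {C : Type u} [Category.{v} C] [Preadditive C] [CategoryTheory.Linear k C]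
  {A : LinearAction k G C}

/-! ### Injectivity of equivariantization -/

theorem isomorphic_of_equivariantization [Fintype G] [HasFiniteBiproducts C] (hs : SplitsOver k G)
    {E E' : EquivAut A} (h : Isomorphic E.equivariantization E'.equivariantization) :
    Isomorphic E E' := by
  obtain ⟨φ, hφ⟩ := h
  let η : ∀ P : EquivObj A, E.F.obj P.X ≅ E'.F.obj P.X := fun P =>
    { hom := (φ.hom.app P).f
      inv := (φ.inv.app P).f
      hom_inv_id := congrArg EquivObj.Hom.f (φ.hom_inv_id_app P)
      inv_hom_id := congrArg EquivObj.Hom.f (φ.inv_hom_id_app P) }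
  -- Both families of structure isomorphisms are identities, so compatibility makes `φ` insensitive
  -- to twists. Its naturality in `C^G` then covers morphisms of every degree.
  have hη : ∀ (χ : G →* kˣ) (P : EquivObj A), (η (twistObj A χ P)).hom = (η P).hom := by
    intro χ P
    have e := congrArg EquivObj.Hom.f (hφ χ P)
    rw [EquivObj.comp_f, EquivObj.comp_f, equivariantization_δ_f, equivariantization_δ_f] at e
    change 𝟙 _ ≫ (η P).hom = (η (twistObj A χ P)).hom ≫ 𝟙 _ at e
    rw [Category.id_comp, Category.comp_id] at e
    exact e.symm
  have hS := retractGenerates_forget A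
  obtain ⟨t, ht⟩ := hS.exists_natIso (F := E.F) (F' := E'.F) η fun P Q f => by
    refine EquivObj.homogeneous_induction (p := fun f => E.F.map f ≫ (η Q).hom = (η P).hom ≫ E'.F.map f) hs ?_ ?_ f
    · intro f f' e e'
      rw [Functor.map_add, Functor.map_add, Preadditive.add_comp, Preadditive.comp_add, e, e']
    · intro χ a
      rw [← hη χ Q]
      exact congrArg EquivObj.Hom.f (φ.hom.naturality a)
  refine ⟨t, fun g X => ?_⟩
  let a : A.F g ⋙ E.F ⟶ E'.F ⋙ A.F g := (E.δ g).hom ≫ Functor.whiskerRight t.hom (A.F g)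
  let b : A.F g ⋙ E.F ⟶ E'.F ⋙ A.F g := Functor.whiskerLeft (A.F g) t.hom ≫ (E'.δ g).hom
  refine hS.natTrans_app_eq a b (fun P => ?_) X
  -- Compatibility with `δ_g` at `P.X` comes from `φ_P` being a morphism of equivariant objects,
  -- after cancelling the image of `P.α g`.
  have h1 := (φ.hom.app P).comm g
  have h2 := t.hom.naturality (P.α g).hom
  change (η P).hom ≫ E'.F.map (P.α g).hom ≫ (E'.δ g).hom.app P.X =
    (E.F.map (P.α g).hom ≫ (E.δ g).hom.app P.X) ≫ (A.F g).map (η P).hom at h1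
  rw [ht] at h2
  have : (E.δ g).hom.app P.X ≫ (A.F g).map (t.hom.app P.X) =
      t.hom.app ((A.F g).obj P.X) ≫ (E'.δ g).hom.app P.X := by
    rw [← cancel_epi (E.F.map (P.α g).hom), reassoc_of% h2, h1, ht, Category.assoc]
  exact this

/-! ### Surjectivity of equivariantization -/

/-- A `Ĝ`-equivariant autoequivalence of `C^G` acts on morphisms `P ⟶ F_χ Q`. -/
def degreeMap (E : EquivAut (dualAction A)) {P Q : EquivObj A} {χ : G →* kˣ}
    (a : P ⟶ twistObj A χ Q) : E.F.obj P ⟶ twistObj A χ (E.F.obj Q) :=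
  E.F.map a ≫ (E.δ χ).hom.app Q

/-- The product of homogeneous morphisms. -/
def degreeComp {P Q R : EquivObj A} {χ ψ : G →* kˣ} (a : P ⟶ twistObj A χ Q)
    (b : Q ⟶ twistObj A ψ R) : P ⟶ twistObj A (χ * ψ) R :=
  a ≫ (twist A χ).map b ≫ (twistCompIso A χ ψ R).hom

theorem degreeComp_f {P Q R : EquivObj A} {χ ψ : G →* kˣ} (a : P ⟶ twistObj A χ Q)
    (b : Q ⟶ twistObj A ψ R) : (degreeComp a b).f = a.f ≫ b.f := by
  change a.f ≫ b.f ≫ 𝟙 _ = _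
  rw [Category.comp_id]

/-- This is where the coherence condition on `(E, δ)` enters: together with naturality of `δ_χ` it
gives multiplicativity across degrees. -/
theorem degreeMap_degreeComp (E : EquivAut (dualAction A)) {P Q R : EquivObj A} {χ ψ : G →* kˣ}
    (a : P ⟶ twistObj A χ Q) (b : Q ⟶ twistObj A ψ R) :
    E.degreeMap (degreeComp a b) = degreeComp (E.degreeMap a) (E.degreeMap b) := by
  have e1 := E.compat χ ψ R
  have e2 := (E.δ χ).hom.naturality b
  change E.F.map (twistCompIso A χ ψ R).hom ≫ (E.δ (χ * ψ)).hom.app R =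
    (E.δ χ).hom.app (twistObj A ψ R) ≫ (twist A χ).map ((E.δ ψ).hom.app R) ≫
      (twistCompIso A χ ψ (E.F.obj R)).hom at e1
  change E.F.map ((twist A χ).map b) ≫ (E.δ χ).hom.app (twistObj A ψ R) =
    (E.δ χ).hom.app Q ≫ (twist A χ).map (E.F.map b) at e2
  change E.F.map (a ≫ (twist A χ).map b ≫ (twistCompIso A χ ψ R).hom) ≫ _ =
    (E.F.map a ≫ (E.δ χ).hom.app Q) ≫
      (twist A χ).map (E.F.map b ≫ (E.δ ψ).hom.app R) ≫ _
  rw [E.F.map_comp, E.F.map_comp, Functor.map_comp, Category.assoc, Category.assoc,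
    Category.assoc, Category.assoc, e1, reassoc_of% e2]

theorem degreeMap_bijective (E : EquivAut (dualAction A)) {P Q : EquivObj A} {χ : G →* kˣ} :
    Function.Bijective (E.degreeMap : (P ⟶ twistObj A χ Q) → _) := by
  constructor
  · intro a b h
    exact E.F.map_injective ((cancel_mono ((E.δ χ).hom.app Q)).1 h)
  · intro b
    obtain ⟨a, ha⟩ := E.F.map_surjective (b ≫ (E.δ χ).inv.app Q)
    refine ⟨a, ?_⟩
    change E.F.map a ≫ _ = _
    rw [ha, Category.assoc]
    erw [Iso.inv_hom_id_app, Category.comp_id]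

/-! ### The induced functor on the orbit category -/

variable [Fintype G] [Fintype (G →* kˣ)]

/-- The extension of a `Ĝ`-equivariant autoequivalence of `C^G` to all morphisms of `C` between
objects underlying equivariant objects. -/
noncomputable def extendMap (E : EquivAut (dualAction A)) (P Q : EquivObj A) (f : P.X ⟶ Q.X) :
    (E.F.obj P).X ⟶ (E.F.obj Q).X :=
  ∑ χ : G →* kˣ, (E.degreeMap (EquivObj.component P Q χ f)).f

variable (E : EquivAut (dualAction A)) {P Q R : EquivObj A}

theorem extendMap_add (f f' : P.X ⟶ Q.X) :
    E.extendMap P Q (f + f') = E.extendMap P Q f + E.extendMap P Q f' := by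
  rw [extendMap, extendMap, extendMap, ← Finset.sum_add_distrib]
  refine Finset.sum_congr rfl fun χ _ => ?_
  rw [EquivObj.component_add, ← EquivObj.add_f, degreeMap, Functor.map_add, Preadditive.add_comp]
  rfl

theorem extendMap_smul (c : k) (f : P.X ⟶ Q.X) :
    E.extendMap P Q (c • f) = c • E.extendMap P Q f := by
  rw [extendMap, extendMap, Finset.smul_sum]
  refine Finset.sum_congr rfl fun χ _ => ?_
  rw [EquivObj.component_smul, ← EquivObj.smul_f, degreeMap, Functor.map_smul,
    CategoryTheory.Linear.smul_comp]
  rfl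

theorem extendMap_homogeneous (hs : SplitsOver k G) {χ : G →* kˣ} (a : P ⟶ twistObj A χ Q) :
    E.extendMap P Q a.f = (E.degreeMap a).f := by
  rw [extendMap, Finset.sum_eq_single χ]
  · rw [EquivObj.component_self hs.card_ne_zero]
  · intro ψ _ h
    rw [EquivObj.component_of_ne h, degreeMap, Functor.map_zero, zero_comp]
    rfl
  · simp

theorem extendMap_comp (hs : SplitsOver k G) (f : P.X ⟶ Q.X) (g : Q.X ⟶ R.X) :
    E.extendMap P R (f ≫ g) = E.extendMap P Q f ≫ E.extendMap Q R g := by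
  refine EquivObj.homogeneous_induction (p := fun f =>
    E.extendMap P R (f ≫ g) = E.extendMap P Q f ≫ E.extendMap Q R g) hs ?_ (fun χ a => ?_) f
  · intro f f' e e'
    rw [Preadditive.add_comp, extendMap_add, extendMap_add, Preadditive.add_comp, e, e']
  refine EquivObj.homogeneous_induction (P := Q) (Q := R) (p := fun f =>
    E.extendMap P R (a.f ≫ f) = E.extendMap P Q a.f ≫ E.extendMap Q R f) hs ?_ (fun ψ b => ?_) g
  · intro f f' e e'
    rw [Preadditive.comp_add, extendMap_add, extendMap_add, Preadditive.comp_add, e, e']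
  have e := E.extendMap_homogeneous hs (degreeComp a b)
  rw [degreeComp_f, degreeMap_degreeComp, degreeComp_f] at e
  rw [extendMap_homogeneous E hs a, extendMap_homogeneous E hs b]
  exact e

theorem extendMap_injective (hs : SplitsOver k G) : Function.Injective (E.extendMap P Q) := by
  -- The extension preserves degrees, so injectivity can be tested one degree at a time.
  have hc : ∀ (χ : G →* kˣ) (f : P.X ⟶ Q.X),
      EquivObj.component _ _ χ (E.extendMap P Q f) =
        E.degreeMap (EquivObj.component P Q χ f) := by
    intro χ f
    refine EquivObj.homogeneous_induction (p := fun f =>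
      EquivObj.component _ _ χ (E.extendMap P Q f) =
        E.degreeMap (EquivObj.component P Q χ f)) hs ?_ (fun ψ a => ?_) f
    · intro f f' e e'
      rw [extendMap_add, EquivObj.component_add, EquivObj.component_add, e, e', degreeMap,
        degreeMap, degreeMap, Functor.map_add, Preadditive.add_comp]
    · rw [extendMap_homogeneous E hs a]
      by_cases h : χ = ψ
      · subst h
        rw [EquivObj.component_self hs.card_ne_zero, EquivObj.component_self hs.card_ne_zero]
      · rw [EquivObj.component_of_ne h, EquivObj.component_of_ne h, degreeMap, Functor.map_zero,
          zero_comp]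
  intro f f' h
  rw [← EquivObj.sum_component hs f, ← EquivObj.sum_component hs f']
  refine Finset.sum_congr rfl fun χ _ => ?_
  congr 1
  apply E.degreeMap_bijective.1
  rw [← hc, ← hc, h]

theorem extendMap_surjective (hs : SplitsOver k G) : Function.Surjective (E.extendMap P Q) := by
  intro b
  refine EquivObj.homogeneous_induction (p := fun b => ∃ f, E.extendMap P Q f = b) hs ?_ ?_ b
  · rintro _ _ ⟨f, rfl⟩ ⟨f', rfl⟩
    exact ⟨f + f', E.extendMap_add f f'⟩
  · intro χ b
    obtain ⟨a, rfl⟩ := E.degreeMap_bijective.2 b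
    exact ⟨a.f, E.extendMap_homogeneous hs a⟩

/-- A surjective multiplicative map preserves the unit, so `δ_1` need not be computed. -/
theorem extendMap_id (hs : SplitsOver k G) (P : EquivObj A) :
    E.extendMap P P (𝟙 P.X) = 𝟙 (E.F.obj P).X := by
  obtain ⟨f, hf⟩ := E.extendMap_surjective hs (𝟙 (E.F.obj P).X)
  rw [← hf, ← Category.comp_id f, extendMap_comp E hs, hf, Category.id_comp]

/-- A morphism of `C^G` has degree `1` only after the identification `u` of `Q` with its trivial
twist. Preservation of identities shows that `u` contributes nothing. -/
theorem extendMap_f (hs : SplitsOver k G) (a : P ⟶ Q) : E.extendMap P Q a.f = (E.F.map a).f := by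
  let u : Q ⟶ twistObj A 1 Q := eqToHom (twist_obj_one A Q).symm
  have hu : u.f = 𝟙 Q.X := by
    rw [eqToHom_f]
    rfl
  have h1 := E.extendMap_homogeneous hs (a ≫ u)
  have h2 := E.extendMap_homogeneous hs u
  have h3 : (a ≫ u).f = a.f := by
    rw [EquivObj.comp_f, hu]
    exact Category.comp_id _
  have h4 : E.degreeMap (a ≫ u) = E.F.map a ≫ E.degreeMap u := by
    rw [degreeMap, degreeMap, Functor.map_comp, Category.assoc]
  rw [hu, extendMap_id E hs] at h2
  rw [h3, h4, EquivObj.comp_f, ← h2] at h1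
  exact h1.trans (Category.comp_id _)

end Isomorphism

/-! ### Descent from `C^G` to `C` -/

section Surjectivity

variable {k : Type w'} [Field k] {G : Type w} [CommGroup G] [Fintype G]
  {C : Type u} [Category.{v} C] [Preadditive C] [CategoryTheory.Linear k C]
  {A : LinearAction k G C} [HasFiniteBiproducts C] [IsIdempotentComplete C]

/-- A `Ĝ`-equivariant autoequivalence of `C^G` descends to an autoequivalence of `C`. -/
theorem exists_descent [Fintype (G →* kˣ)] (hs : SplitsOver k G) (E : EquivAut (dualAction A)) :
    ∃ (F : C ⥤ C) (θ : ∀ P : EquivObj A, F.obj P.X ≅ (E.F.obj P).X),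
      F.IsEquivalence ∧ F.Additive ∧ F.Linear k ∧
      ∀ (P Q : EquivObj A) (f : P.X ⟶ Q.X),
        F.map f ≫ (θ Q).hom = (θ P).hom ≫ E.extendMap P Q f := by
  have hS := retractGenerates_forget A
  obtain ⟨F, θ, hθ⟩ := hS.exists_functor (fun P => (E.F.obj P).X)
    (fun {P Q} f => E.extendMap P Q f) (fun P => E.extendMap_id hs P)
    (fun f g => E.extendMap_comp hs f g)
  have hadd : F.Additive := hS.additive F fun P Q f g => by
    rw [← cancel_mono (θ Q).hom, Preadditive.add_comp, hθ, hθ, hθ, extendMap_add,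
      Preadditive.comp_add]
  have hlin : F.Linear k := hS.linear F fun P Q c f => by
    rw [← cancel_mono (θ Q).hom, CategoryTheory.Linear.smul_comp, hθ, hθ, extendMap_smul,
      CategoryTheory.Linear.comp_smul]
  have hfaithful : F.Faithful := hS.faithful F fun P Q f g h => by
    rw [← cancel_mono (θ Q).hom, hθ, hθ, cancel_epi] at h
    exact E.extendMap_injective hs h
  have hfull : F.Full := hS.full F fun P Q b => by
    obtain ⟨f, hf⟩ := E.extendMap_surjective hs ((θ P).inv ≫ b ≫ (θ Q).hom)
    refine ⟨f, ?_⟩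
    rw [← cancel_mono (θ Q).hom, hθ, hf, Iso.hom_inv_id_assoc]
  -- `Y` is a retract of some `Q.X`, and `Q` is isomorphic to a value of `E.F`, whose underlying
  -- object is in the image of `F` up to `θ`.
  have hess : F.EssSurj := essSurj_of_retract F fun Y => by
    obtain ⟨Q, ⟨r⟩⟩ := hS Y
    let i : E.F.obj (E.F.objPreimage Q) ≅ Q := E.F.objObjPreimageIso Q
    let j : (E.F.obj (E.F.objPreimage Q)).X ≅ Q.X :=
      ⟨i.hom.f, i.inv.f, congrArg EquivObj.Hom.f i.hom_inv_id,
        congrArg EquivObj.Hom.f i.inv_hom_id⟩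
    exact ⟨(E.F.objPreimage Q).X, ⟨r.trans (.ofIso (j.symm ≪≫ (θ _).symm))⟩⟩
  exact ⟨F, θ, {}, hadd, hlin, hθ⟩

theorem exists_equivariantization_isomorphic (hs : SplitsOver k G)
    (E : EquivAut (dualAction A)) : ∃ E' : EquivAut A, Isomorphic E'.equivariantization E := by
  have := finite_characters k G
  have := Fintype.ofFinite (G →* kˣ)
  obtain ⟨F, θ, hequiv, hadd, hlin, hθ⟩ := exists_descent hs E
  have hS := retractGenerates_forget A
  -- This choice of `δ_g` at `P.X` is forced by requiring `θ P` to be an isomorphism of equivariant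
  -- objects.
  let d : ∀ (g : G) (P : EquivObj A), F.obj ((A.F g).obj P.X) ≅ (A.F g).obj (F.obj P.X) :=
    fun g P => F.mapIso (P.α g).symm ≪≫ θ P ≪≫ (E.F.obj P).α g ≪≫ (A.F g).mapIso (θ P).symm
  have hd : ∀ g P, F.map (P.α g).hom ≫ (d g P).hom ≫ (A.F g).map (θ P).hom =
      (θ P).hom ≫ ((E.F.obj P).α g).hom := by
    intro g P
    simp only [d, Iso.trans_hom, Functor.mapIso_hom, Iso.symm_hom, Category.assoc]
    rw [Iso.map_hom_inv_id_assoc, Iso.map_inv_hom_id, Category.comp_id]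
  have hd_nat : ∀ g (P Q : EquivObj A) (f : P.X ⟶ Q.X),
      F.map ((A.F g).map f) ≫ (d g Q).hom = (d g P).hom ≫ (A.F g).map (F.map f) := by
    intro g P Q f
    refine EquivObj.homogeneous_induction (p := fun f =>
      F.map ((A.F g).map f) ≫ (d g Q).hom = (d g P).hom ≫ (A.F g).map (F.map f)) hs ?_ ?_ f
    · intro f f' e e'
      simp only [Functor.map_add, Preadditive.add_comp, Preadditive.comp_add, e, e']
    -- A morphism of degree `χ` and its image under `degreeMap` carry the same scalar `χ(g⁻¹)`, so
    -- the two sides agree.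
    · intro χ a
      have h1 : a.f ≫ (((χ g⁻¹ : kˣ) : k) • (Q.α g).hom) = (P.α g).hom ≫ (A.F g).map a.f :=
        a.comm g
      have h2 : (E.degreeMap a).f ≫ (((χ g⁻¹ : kˣ) : k) • ((E.F.obj Q).α g).hom) =
          ((E.F.obj P).α g).hom ≫ (A.F g).map (E.degreeMap a).f := (E.degreeMap a).comm g
      have h3 : F.map a.f ≫ (θ Q).hom = (θ P).hom ≫ (E.degreeMap a).f :=
        (hθ P Q a.f).trans (congrArg _ (E.extendMap_homogeneous hs a))
      have goal : F.map (P.α g).hom ≫ (F.map ((A.F g).map a.f) ≫ (d g Q).hom) ≫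
          (A.F g).map (θ Q).hom = F.map (P.α g).hom ≫ ((d g P).hom ≫
            (A.F g).map (F.map a.f)) ≫ (A.F g).map (θ Q).hom := by
        simp only [Category.assoc]
        rw [← Functor.map_comp (A.F g), h3, Functor.map_comp, reassoc_of% (hd g P), ← h2,
          ← Functor.map_comp_assoc, ← h1, Functor.map_comp, Functor.map_smul,
          CategoryTheory.Linear.comp_smul, CategoryTheory.Linear.smul_comp, Category.assoc, hd,
          reassoc_of% h3, CategoryTheory.Linear.comp_smul, CategoryTheory.Linear.comp_smul]
      rw [cancel_epi, cancel_mono] at goal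
      exact goal
  have hδ := fun g => hS.exists_natIso (F := A.F g ⋙ F) (F' := F ⋙ A.F g) (d g) (hd_nat g)
  choose δ hδ using hδ
  have hδ' : ∀ g (P : EquivObj A),
      F.map (P.α g).hom ≫ (δ g).hom.app P.X ≫ (A.F g).map (θ P).hom =
        (θ P).hom ≫ ((E.F.obj P).α g).hom := fun g P => by rw [hδ, hd]
  let E' : EquivAut A :=
    { F := F
      isEquivalence := hequiv
      additive := hadd
      linear := hlin
      δ := δ
      compat := fun g h X => by
        let a : (A.F h ⋙ A.F g) ⋙ F ⟶ F ⋙ A.F (g * h) :=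
          Functor.whiskerRight (A.ε g h).hom F ≫ (δ (g * h)).hom
        let b : (A.F h ⋙ A.F g) ⋙ F ⟶ F ⋙ A.F (g * h) :=
          (Functor.associator _ _ _).hom ≫ Functor.whiskerLeft (A.F h) (δ g).hom ≫
            (Functor.associator _ _ _).inv ≫ Functor.whiskerRight (δ h).hom (A.F g) ≫
              (Functor.associator _ _ _).hom ≫ Functor.whiskerLeft F (A.ε g h).hom
        -- On underlying objects the coherence of `δ` reduces to the relations for `α_{gh}` on `P`
        -- and on `E.F.obj P`.
        have key : ∀ P : EquivObj A,
            F.map ((A.ε g h).hom.app P.X) ≫ (δ (g * h)).hom.app P.X =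
              (δ g).hom.app ((A.F h).obj P.X) ≫ (A.F g).map ((δ h).hom.app P.X) ≫
                (A.ε g h).hom.app (F.obj P.X) := by
          intro P
          have n1 := (δ g).hom.naturality (P.α h).hom
          have n2 := (A.ε g h).hom.naturality (θ P).hom
          have r1 := P.rel g h
          have r2 := (E.F.obj P).rel g h
          dsimp at n1 n2
          rw [← cancel_epi (F.map ((A.F g).map (P.α h).hom)), ← cancel_epi (F.map (P.α g).hom),
            ← cancel_mono ((A.F (g * h)).map (θ P).hom)]
          simp only [Category.assoc]
          rw [← n2, reassoc_of% n1, ← Functor.map_comp_assoc (A.F g) ((δ h).hom.app P.X),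
            ← Functor.map_comp_assoc (A.F g) (F.map (P.α h).hom), hδ' h P, Functor.map_comp,
            Category.assoc, reassoc_of% (hδ' g P), ← r2, ← hδ' (g * h) P, r1]
          simp only [Functor.map_comp, Category.assoc]
        have := hS.natTrans_app_eq a b (fun P => by simpa [a, b] using key P) X
        simpa [a, b] using this }
  refine ⟨E', NatIso.ofComponents (fun P => EquivObj.isoMk (θ P) fun g => ?_) ?_, ?_⟩
  · have := hδ' g P
    change (θ P).hom ≫ ((E.F.obj P).α g).hom =
      (F.map (P.α g).hom ≫ (δ g).hom.app P.X) ≫ (A.F g).map (θ P).hom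
    rw [Category.assoc, this]
  · intro P Q a
    ext
    exact (hθ P Q a.f).trans (congrArg _ (E.extendMap_f hs a))
  · intro χ P
    ext
    rw [EquivObj.comp_f, EquivObj.comp_f, equivariantization_δ_f]
    -- The identity of `P.X`, read as a map from the twist of `P` to `P`, has degree `χ`, and its
    -- image under the extension is `δ_χ`. Naturality of `θ` there is the required compatibility.
    have h1 := hθ (twistObj A χ P) P (𝟙 P.X)
    have h2 := E.extendMap_homogeneous hs (𝟙 (twistObj A χ P))
    have h3 : E.degreeMap (𝟙 (twistObj A χ P)) = (E.δ χ).hom.app P := by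
      rw [degreeMap, E.F.map_id]
      exact Category.id_comp _
    rw [h3] at h2
    change 𝟙 _ ≫ (θ P).hom = (θ (twistObj A χ P)).hom ≫ ((E.δ χ).hom.app P).f
    rw [← h2]
    refine Eq.trans ?_ h1
    rw [F.map_id]

end Surjectivity

end EquivAut

end Equivariantization

theorem theorem5p4 {k : Type w'} [Field k] {G : Type w} [CommGroup G] [Finite G]
    {C : Type u} [Category.{v} C] [Preadditive C] [CategoryTheory.Linear k C]
    [HasFiniteBiproducts C] [IsIdempotentComplete C]
    (hsplit : Equivariantization.SplitsOver k G)
    (A : Equivariantization.LinearAction k G C) :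
    Function.Bijective (Equivariantization.EquivAut.equivariantizationHom A) ∧
      ∀ E : Equivariantization.EquivAut (Equivariantization.dualAction A),
        ∃ E' : Equivariantization.EquivAut (Equivariantization.dualAction A),
          E'.IsStrict ∧ E.Isomorphic E' := by
  have := Fintype.ofFinite G
  have hsurj := Equivariantization.EquivAut.exists_equivariantization_isomorphic (A := A) hsplit
  refine ⟨⟨?_, ?_⟩, fun E => ?_⟩
  · rintro ⟨E⟩ ⟨E'⟩ h
    exact Equivariantization.EquivAut.cls_eq_iff.2
      (Equivariantization.EquivAut.isomorphic_of_equivariantization hsplit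
        (Equivariantization.EquivAut.cls_eq_iff.1 h))
  · rintro ⟨E⟩
    obtain ⟨E', h⟩ := hsurj E
    exact ⟨Equivariantization.EquivAut.cls E', Equivariantization.EquivAut.cls_eq_iff.2 h⟩
  -- Equivariantizations are strict by construction, so surjectivity gives the strict
  -- representative.
  · obtain ⟨E', h⟩ := hsurj E
    exact ⟨E'.equivariantization, fun χ => ⟨E'.lift_twist χ, rfl⟩, h.symm⟩
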